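/- For integers $q\ge 0$, $s_1,\dots,s_q\in\mathbb{Z}$ and complex numbers $w_1,\dots,w_q$, put $$\mathrm{La}_{s_1,\dots,s_q}(w_1,\dots,w_q)=\sum_{k_1\ge\cdots\ge k_q\ge1}\frac{w_1^{k_1}\cdots w_q^{k_q}}{k_1^{s_1}\cdots k_q^{s_q}}$$ whenever this series converges absolutely; for $q=0$ this is the constant $1$. Write $(x)_m=x(x+1)\cdots(x+m-1)$. Theorem. Let $p\ge1$, let $P\in\mathbb{Q}[X_1,\dots,X_p]$, and let $A_j\ge1$ and $n_j\ge0$ $(1\le j\le p)$ be integers. Then there exist finitely many data $(q_t,\underline{s}_t,\underline{S}_t,c_t)$, $t=1,\dots,m$, depending only on $P$ and the $A_j,n_j$ (and not on $z$), where - $q_t$ is an integer with $0\le q_t\le p$; - $\underline{s}_t=(s_{t,1},\dots,s_{t,q_t})$ is a tuple of integers of any sign with $\sum_{i=1}^{q_t}\max(s_{t,i},0)\le\sum_{j=1}^pA_j$; - $\underline{S}_t=(S_{t,1},\dots,S_{t,q_t})$ is a tuple of non-empty subsets of $\{1,\dots,p\}$; - $c_t\in\mathbb{Q}[z_1^{\pm1},\dots,z_p^{\pm1}]$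 is a Laurent polynomial, such that for all $z_1,\dots,z_p\in\mathbb{C}$ with $|z_1|>1$ and $|z_j|\ge1$ for $j=2,\dots,p$ the following holds. Put $\widehat z_{t,i}=\prod_{j\in S_{t,i}}z_j$. Then the series defining $\mathrm{La}_{\underline{s}_t}(1/\widehat z_{t,1},\dots,1/\widehat z_{t,q_t})$ converges absolutely for every $t$, and $$\sum_{k_1\ge\cdots\ge k_p\ge1}\frac{P(k_1,\dots,k_p)}{(k_1)_{n_1+1}^{A_1}\cdots(k_p)_{n_p+1}^{A_p}}\,z_1^{-k_1}\cdots z_p^{-k_p} =\sum_{t=1}^m c_t(z_1,\dots,z_p)\,\mathrm{La}_{\underline{s}_t}(1/\widehat z_{t,1},\dots,1/\widehat z_{t,q_t}),$$ the series on the left converging absolutely. -/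

import Mathlib

noncomputable section

namespace MultiplePolylog

/-- The index set of the sums: the `q`-tuples of integers `k₁ ≥ k₂ ≥ ⋯ ≥ k_q ≥ 1`.
For `q = 0` it consists of the empty tuple alone. -/
abbrev Index (q : ℕ) : Type := {k : Fin q → ℕ // Antitone k ∧ ∀ i, 1 ≤ k i}

/-- The general term `∏ wᵢ ^ kᵢ / kᵢ ^ sᵢ` of a large multiple polylogarithm, with exponents
`sᵢ ∈ ℤ` of any sign. -/
def laTerm {q : ℕ} (s : Fin q → ℤ) (w : Fin q → ℂ) (k : Index q) : ℂ :=
  ∏ i, w i ^ k.1 i / (k.1 i : ℂ) ^ s i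

/-- The large multiple polylogarithm `La_{s₁,…,s_q}(w₁,…,w_q)`, the sum of `laTerm` over
`k₁ ≥ ⋯ ≥ k_q ≥ 1`. In depth `q = 0` it equals `1`. -/
def La {q : ℕ} (s : Fin q → ℤ) (w : Fin q → ℂ) : ℂ :=
  ∑' k : Index q, laTerm s w k

/-- The weight `∑ max(sᵢ, 0)`. -/
def weight {q : ℕ} (s : Fin q → ℤ) : ℤ :=
  ∑ i, max (s i) 0

/-- Laurent polynomials `ℚ[z₁^{±1}, …, z_p^{±1}]`: the group algebra over `ℚ` of the group `ℤᵖ` of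
exponent vectors. -/
abbrev Laurent (p : ℕ) : Type := AddMonoidAlgebra ℚ (Fin p → ℤ)

/-- The value of a Laurent polynomial at a point `z` (with nonzero coordinates). -/
def Laurent.evalAt {p : ℕ} (z : Fin p → ℂ) (c : Laurent p) : ℂ :=
  c.coeff.sum fun e a => (a : ℂ) * ∏ j, z j ^ e j

/-- The general term
`P(k₁,…,k_p) / ((k₁)_{n₁+1}^{A₁} ⋯ (k_p)_{n_p+1}^{A_p}) · z₁^{-k₁} ⋯ z_p^{-k_p}`,
where `(x)_m = x (x+1) ⋯ (x+m-1)`. -/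
def seriesTerm {p : ℕ} (P : MvPolynomial (Fin p) ℚ) (A n : Fin p → ℕ) (z : Fin p → ℂ)
    (k : Index p) : ℂ :=
  MvPolynomial.aeval (fun j => (k.1 j : ℂ)) P /
      (∏ j, ((ascPochhammer ℂ (n j + 1)).eval (k.1 j : ℂ)) ^ A j) *
    ∏ j, z j ^ (-(k.1 j : ℤ))

end MultiplePolylog

end

open MultiplePolylog

namespace MultiplePolylog

open Finset Filter Topology

/-! Two elementary operations turn the series into polylogarithms.

Partial fractions: in each variable the summand is a combination of powers `(k + i) ^ (-s)` with `s
≤ A j`, since the factors of a Pochhammer symbol have distinct simple zeros. The spaces `polar a`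
record this; by `polar_mul` pole orders at worst add under products.

Summation by parts: reindexing an outer sum of `(k + i + 1) ^ (-s) z ^ (-k v) T(k)` lowers the shift
`i` at the cost of a Laurent monomial, a boundary term, and a correction from `T(k + 1) - T(k)`. The
correction merges two adjacent summation variables: depth falls by one, exponent vectors add, weight
does not grow. Induction on depth and then on shift removes all shifts (`sumOp_pureNest_mem`,
`sumOp_mem`, `nest_mem`).

This is done for truncated sums, where convergence plays no role. The sum of all exponent vectors
stays at most `(1, …, 1)`, so every vector is the indicator of a subset; the first one always
contains the first coordinate. Hence, as the truncation grows, boundary terms vanish and the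
remaining sums converge absolutely (`exists_tendsto_of_mem_nestSpan`). -/

/-! ### Partial fractions with poles at integers `≤ 0`. -/

/-- The function `k ↦ (k + i) ^ (-s)` on the integers `k = m + 1 ≥ 1`, indexed by `m`. -/
def shiftedPow (i : ℕ) (s : ℤ) (m : ℕ) : ℚ := ((m : ℚ) + 1 + i) ^ (-s)

/-- The rational functions of `k = m + 1` whose poles are integers `≤ 0` of order at most `a`. -/
def polar (a : ℕ) : Submodule ℚ (ℕ → ℚ) :=
  Submodule.span ℚ {f | ∃ (i : ℕ) (s : ℤ), s ≤ a ∧ f = shiftedPow i s}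

lemma shift_ne_zero (m i : ℕ) : (m : ℚ) + 1 + i ≠ 0 := by positivity

lemma shiftedPow_mem {a : ℕ} (i : ℕ) {s : ℤ} (h : s ≤ a) : shiftedPow i s ∈ polar a :=
  Submodule.subset_span ⟨i, s, h, rfl⟩

lemma polar_mono {a b : ℕ} (h : a ≤ b) : polar a ≤ polar b := by
  refine Submodule.span_mono ?_
  rintro f ⟨i, s, hs, rfl⟩
  exact ⟨i, s, by omega, rfl⟩

lemma polar_map_le {a b : ℕ} (T : (ℕ → ℚ) →ₗ[ℚ] (ℕ → ℚ))
    (h : ∀ (i : ℕ) (s : ℤ), s ≤ a → T (shiftedPow i s) ∈ polar b) {f : ℕ → ℚ}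
    (hf : f ∈ polar a) : T f ∈ polar b := by
  have : polar a ≤ (polar b).comap T := by
    refine Submodule.span_le.2 ?_
    rintro f ⟨i, s, hs, rfl⟩
    exact h i s hs
  exact this hf

lemma polar_shift {a : ℕ} {f : ℕ → ℚ} (hf : f ∈ polar a) : (fun m => f (m + 1)) ∈ polar a := by
  refine polar_map_le (LinearMap.funLeft ℚ ℚ (· + 1)) (fun i s hs => ?_) hf
  have : LinearMap.funLeft ℚ ℚ (· + 1) (shiftedPow i s) = shiftedPow (i + 1) s := by
    ext m
    simp only [LinearMap.funLeft_apply, shiftedPow]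
    push_cast
    ring_nf
  rw [this]
  exact shiftedPow_mem _ hs

lemma shiftedPow_mul_same (i : ℕ) (s t : ℤ) :
    shiftedPow i s * shiftedPow i t = shiftedPow i (s + t) := by
  ext m
  simp only [shiftedPow, Pi.mul_apply]
  rw [← zpow_add₀ (shift_ne_zero m i)]
  ring_nf

lemma shiftedPow_neg_one_sub (i j : ℕ) :
    shiftedPow j (-1) = shiftedPow i (-1) + ((j : ℚ) - i) • shiftedPow i 0 := by
  ext m
  simp [shiftedPow]

/-- Writing `k + j = (k + i) + (j - i)`, each term either loses one order of pole at `-i` or keeps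
it. -/
lemma polar_mul_linear {a : ℕ} (j : ℕ) {f : ℕ → ℚ} (hf : f ∈ polar a) :
    shiftedPow j (-1) * f ∈ polar a := by
  refine polar_map_le (LinearMap.mulLeft ℚ (shiftedPow j (-1))) (fun i s hs => ?_) hf
  rw [LinearMap.mulLeft_apply, shiftedPow_neg_one_sub i j, add_mul, smul_mul_assoc,
    shiftedPow_mul_same, shiftedPow_mul_same]
  exact add_mem (shiftedPow_mem _ (by omega)) (Submodule.smul_mem _ _ (shiftedPow_mem _ (by omega)))

lemma polar_mul_linear_pow {a : ℕ} (j l : ℕ) {f : ℕ → ℚ} (hf : f ∈ polar a) :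
    shiftedPow j (-l) * f ∈ polar a := by
  induction l with
  | zero =>
    convert hf using 1
    ext m
    simp [shiftedPow]
  | succ l ih =>
    have := polar_mul_linear j ih
    rwa [← mul_assoc, shiftedPow_mul_same, show (-1 + -(l : ℤ)) = -((l + 1 : ℕ) : ℤ) by
      push_cast; ring] at this

/-- The difference `(k + i) - (k + j) = i - j` is constant; dividing by `(k + j)(k + i) ^ s`
separates the two poles. -/
lemma shiftedPow_one_mul {i j : ℕ} (h : i ≠ j) (s : ℤ) :
    shiftedPow j 1 * shiftedPow i s =
      ((i : ℚ) - j)⁻¹ • (shiftedPow j 1 * shiftedPow i (s - 1) - shiftedPow i s) := by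
  have hij : (i : ℚ) - j ≠ 0 := sub_ne_zero.2 (by exact_mod_cast h)
  ext m
  simp only [shiftedPow, Pi.mul_apply, Pi.smul_apply, Pi.sub_apply, smul_eq_mul]
  have hi := shift_ne_zero m i
  have hj := shift_ne_zero m j
  rw [show -(s - 1) = -s + 1 by ring, zpow_add₀ hi, zpow_neg, zpow_neg, zpow_one, zpow_one]
  field_simp
  ring

/-- Distinct poles separate, so their orders contribute through a maximum rather than a sum. -/
lemma shiftedPow_one_mul_mem {i j : ℕ} (h : i ≠ j) (s : ℕ) :
    shiftedPow j 1 * shiftedPow i s ∈ polar (max s 1) := by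
  induction s with
  | zero =>
    have := shiftedPow_mem (a := 1) j (s := 1) (by simp)
    have h0 : shiftedPow i (0 : ℕ) = 1 := by
      ext m
      simp [shiftedPow]
    rwa [h0, mul_one]
  | succ s ih =>
    rw [shiftedPow_one_mul h]
    refine Submodule.smul_mem _ _ (sub_mem ?_ (shiftedPow_mem _ (by push_cast; omega)))
    rw [show ((s + 1 : ℕ) : ℤ) - 1 = s by push_cast; ring]
    exact polar_mono (by omega) ih

lemma polar_mul_inv {a : ℕ} (j : ℕ) {f : ℕ → ℚ} (hf : f ∈ polar a) :
    shiftedPow j 1 * f ∈ polar (a + 1) := by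
  refine polar_map_le (LinearMap.mulLeft ℚ (shiftedPow j 1)) (fun i s hs => ?_) hf
  rw [LinearMap.mulLeft_apply]
  by_cases h : i = j
  · subst h
    rw [shiftedPow_mul_same]
    exact shiftedPow_mem _ (by push_cast; omega)
  · obtain ⟨l, rfl | rfl⟩ := s.eq_nat_or_neg
    · exact polar_mono (by omega) (shiftedPow_one_mul_mem h l)
    · rw [mul_comm]
      exact polar_mul_linear_pow i l (shiftedPow_mem j (by push_cast; omega))

/-- Multiplication by a power of `k + j` proceeds one factor at a time: an inverse factor costs one
unit of pole order, a polynomial factor costs nothing. -/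
lemma polar_mul {a b : ℕ} {f g : ℕ → ℚ} (hf : f ∈ polar a) (hg : g ∈ polar b) :
    f * g ∈ polar (a + b) := by
  refine polar_map_le (LinearMap.mulLeft ℚ f) (fun j s hs => ?_) hg
  rw [LinearMap.mulLeft_apply, mul_comm]
  obtain ⟨l, rfl | rfl⟩ := s.eq_nat_or_neg
  · refine polar_mono (show a + l ≤ a + b by omega) ?_
    clear hs
    induction l with
    | zero => simpa using polar_mul_linear_pow j 0 hf
    | succ l ih =>
      have := polar_mul_inv j ih
      rwa [← mul_assoc, shiftedPow_mul_same, show (1 + (l : ℤ)) = ((l + 1 : ℕ) : ℤ) by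
        push_cast; ring] at this
  · exact polar_mono (by omega) (polar_mul_linear_pow j l hf)

lemma polar_pow {a : ℕ} {f : ℕ → ℚ} (hf : f ∈ polar a) (l : ℕ) : f ^ l ∈ polar (l * a) := by
  induction l with
  | zero =>
    convert shiftedPow_mem (a := 0 * a) 0 (s := 0) (by simp) using 1
    ext m
    simp [shiftedPow]
  | succ l ih =>
    rw [pow_succ, Nat.succ_mul]
    exact polar_mul ih hf

/-- The bound `i ≤ n` on the poles drives the induction: the new pole `-(n + 1)` differs from all
previous ones, so all poles stay simple and the weight is `1`, not `n + 1`. -/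
lemma inv_ascPochhammer_mem_span (n : ℕ) :
    (fun m : ℕ => ((ascPochhammer ℚ (n + 1)).eval ((m : ℚ) + 1))⁻¹) ∈
      Submodule.span ℚ {f | ∃ i : ℕ, i ≤ n ∧ f = shiftedPow i 1} := by
  induction n with
  | zero =>
    refine Submodule.subset_span ⟨0, le_rfl, ?_⟩
    ext m
    simp [shiftedPow]
  | succ n ih =>
    have key : Submodule.span ℚ {f | ∃ i : ℕ, i ≤ n ∧ f = shiftedPow i 1} ≤
        (Submodule.span ℚ {f | ∃ i : ℕ, i ≤ n + 1 ∧ f = shiftedPow i 1}).comap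
          (LinearMap.mulLeft ℚ (shiftedPow (n + 1) 1)) := by
      refine Submodule.span_le.2 ?_
      rintro f ⟨i, hi, rfl⟩
      simp only [SetLike.mem_coe, Submodule.mem_comap, LinearMap.mulLeft_apply]
      rw [shiftedPow_one_mul (by omega)]
      refine Submodule.smul_mem _ _ (sub_mem ?_ (Submodule.subset_span ⟨i, by omega, rfl⟩))
      refine Submodule.subset_span ⟨n + 1, le_rfl, ?_⟩
      rw [show ((1 : ℤ) - 1) = 0 by ring]
      ext m
      simp [shiftedPow]
    have h := key ih
    rw [Submodule.mem_comap] at h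
    convert h using 1
    ext m
    simp only [LinearMap.mulLeft_apply, Pi.mul_apply, shiftedPow]
    rw [ascPochhammer_succ_eval, mul_inv, mul_comm, zpow_neg, zpow_one]

lemma inv_ascPochhammer_mem (n : ℕ) :
    (fun m : ℕ => ((ascPochhammer ℚ (n + 1)).eval ((m : ℚ) + 1))⁻¹) ∈ polar 1 := by
  refine Submodule.span_mono ?_ (inv_ascPochhammer_mem_span n)
  rintro f ⟨i, -, rfl⟩
  exact ⟨i, 1, by simp, rfl⟩

lemma monomial_div_ascPochhammer_mem (l n A : ℕ) :
    (fun m : ℕ => ((m : ℚ) + 1) ^ l / ((ascPochhammer ℚ (n + 1)).eval ((m : ℚ) + 1)) ^ A) ∈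
      polar A := by
  have h := polar_mul_linear_pow 0 l (polar_pow (inv_ascPochhammer_mem n) A)
  rw [mul_one] at h
  convert h using 1
  ext m
  simp [shiftedPow, div_eq_mul_inv]

/-! ### Truncated nested sums and their limits. -/

/-- The nested sum `∑_{K ≥ k₁ ≥ ⋯ ≥ k_q ≥ 1} g₁(k₁ - 1) ⋯ g_q(k_q - 1)`. -/
def nest {R : Type*} [Semiring R] : List (ℕ → R) → ℕ → R
  | [], _ => 1
  | g :: L, K => ∑ m ∈ range K, g m * nest L (m + 1)

/-- The tuples `K ≥ k₁ ≥ ⋯ ≥ k_q ≥ 1`. -/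
def boundedIndex (q K : ℕ) : Finset (Fin q → ℕ) :=
  open Classical in
  {k ∈ Fintype.piFinset fun _ => Icc 1 K | Antitone k}

lemma mem_boundedIndex {q K : ℕ} {k : Fin q → ℕ} :
    k ∈ boundedIndex q K ↔ Antitone k ∧ ∀ i, 1 ≤ k i ∧ k i ≤ K := by
  simp [boundedIndex, and_comm]

lemma cons_mem_boundedIndex {q K a : ℕ} {k : Fin q → ℕ} :
    (Fin.cons a k : Fin (q + 1) → ℕ) ∈ boundedIndex (q + 1) K ↔
      (1 ≤ a ∧ a ≤ K) ∧ k ∈ boundedIndex q a := by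
  simp only [mem_boundedIndex]
  constructor
  · rintro ⟨h, hk⟩
    refine ⟨by simpa using hk 0, fun i j hij => ?_, fun i => ⟨by simpa using (hk i.succ).1, ?_⟩⟩
    · simpa using h (Fin.succ_le_succ_iff.2 hij)
    · simpa using h (Fin.zero_le i.succ)
  · rintro ⟨⟨h1, h2⟩, h, hk⟩
    refine ⟨fun i j hij => ?_, fun i => ?_⟩
    · induction i using Fin.cases with
      | zero =>
        induction j using Fin.cases with
        | zero => simp
        | succ j => simpa using (hk j).2
      | succ i =>
        induction j using Fin.cases with
        | zero => exact absurd hij (by simp)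
        | succ j => simpa using h (Fin.succ_le_succ_iff.1 hij)
    · induction i using Fin.cases with
      | zero => simpa using ⟨h1, h2⟩
      | succ i => simpa using ⟨(hk i).1, (hk i).2.trans h2⟩

lemma nest_ofFn {R : Type*} [CommSemiring R] {q : ℕ} (g : Fin q → ℕ → R) (K : ℕ) :
    nest (List.ofFn g) K = ∑ k ∈ boundedIndex q K, ∏ i, g i (k i - 1) := by
  induction q generalizing K with
  | zero =>
    have : boundedIndex 0 K = {Fin.elim0} := by
      ext k
      simp only [mem_boundedIndex, mem_singleton, Subsingleton.elim k Fin.elim0, iff_true]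
      exact ⟨fun i => i.elim0, fun i => i.elim0⟩
    simp [nest, this]
  | succ q ih =>
    rw [List.ofFn_succ, nest]
    simp_rw [ih, mul_sum]
    rw [sum_sigma']
    refine sum_bij' (fun x _ => (Fin.cons (x.1 + 1) x.2 : Fin (q + 1) → ℕ))
      (fun k _ => ⟨k 0 - 1, Fin.tail k⟩) ?_ ?_ ?_ ?_ ?_
    · rintro ⟨a, k⟩ h
      simp only [mem_sigma, mem_range] at h
      exact cons_mem_boundedIndex.2 ⟨⟨Nat.succ_pos a, h.1⟩, h.2⟩
    · intro k h
      rw [← Fin.cons_self_tail k, cons_mem_boundedIndex] at h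
      simp only [mem_sigma, mem_range]
      refine ⟨by omega, ?_⟩
      rw [Nat.sub_add_cancel h.1.1]
      exact h.2
    · rintro ⟨a, k⟩ h
      simp
    · intro k h
      rw [Nat.sub_add_cancel ((mem_boundedIndex.1 h).2 0).1]
      exact Fin.cons_self_tail k
    · rintro ⟨a, k⟩ h
      simp [Fin.prod_univ_succ]

/-- The index set `boundedIndex q K` inside `Index q`. -/
def truncation (q K : ℕ) : Finset (Index q) :=
  open Classical in
  (boundedIndex q K).subtype fun k => Antitone k ∧ ∀ i, 1 ≤ k i

lemma mem_truncation {q K : ℕ} {k : Index q} : k ∈ truncation q K ↔ ∀ i, k.1 i ≤ K := by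
  classical
  simp only [truncation, mem_subtype, mem_boundedIndex]
  exact ⟨fun h i => (h.2 i).2, fun h => ⟨k.2.1, fun i => ⟨k.2.2 i, h i⟩⟩⟩

lemma sum_truncation {R : Type*} [CommSemiring R] {q : ℕ} (g : Fin q → ℕ → R) (K : ℕ) :
    ∑ k ∈ truncation q K, ∏ i, g i (k.1 i - 1) = nest (List.ofFn g) K := by
  classical
  rw [nest_ofFn, truncation]
  rw [sum_subtype_of_mem (fun k : Fin q → ℕ => ∏ i, g i (k i - 1))]
  intro k hk
  rw [mem_boundedIndex] at hk
  exact ⟨hk.1, fun i => (hk.2 i).1⟩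

lemma truncation_mono (q : ℕ) : Monotone (truncation q) := fun _ _ h _ hk =>
  mem_truncation.2 fun i => (mem_truncation.1 hk i).trans h

lemma exists_mem_truncation {q : ℕ} (k : Index q) : ∃ K, k ∈ truncation q K :=
  ⟨∑ i, k.1 i, mem_truncation.2 fun i => single_le_sum (f := k.1) (by simp) (mem_univ i)⟩

lemma tendsto_truncation (q : ℕ) : Tendsto (truncation q) atTop atTop :=
  tendsto_atTop_finset_of_monotone (truncation_mono q) exists_mem_truncation

lemma tendsto_nest {q : ℕ} {g : Fin q → ℕ → ℂ}
    (h : Summable fun k : Index q => ∏ i, g i (k.1 i - 1)) :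
    Tendsto (nest (List.ofFn g)) atTop (𝓝 (∑' k : Index q, ∏ i, g i (k.1 i - 1))) := by
  have := h.hasSum.comp (tendsto_truncation q)
  refine this.congr fun K => ?_
  simp [← sum_truncation]

/-! ### Polynomial growth and absolute convergence. -/

/-- Sequences of at most polynomial growth. -/
def PolyBounded (g : ℕ → ℂ) : Prop := ∃ (C : ℝ) (d : ℕ), 0 ≤ C ∧ ∀ m, ‖g m‖ ≤ C * ((m : ℝ) + 1) ^ d

lemma PolyBounded.mul {f g : ℕ → ℂ} (hf : PolyBounded f) (hg : PolyBounded g) :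
    PolyBounded (fun m => f m * g m) := by
  obtain ⟨C, d, hC, h⟩ := hf
  obtain ⟨C', d', hC', h'⟩ := hg
  refine ⟨C * C', d + d', by positivity, fun m => ?_⟩
  rw [norm_mul, pow_add, mul_mul_mul_comm]
  exact mul_le_mul (h m) (h' m) (norm_nonneg _) (by positivity)

lemma PolyBounded.add {f g : ℕ → ℂ} (hf : PolyBounded f) (hg : PolyBounded g) :
    PolyBounded (fun m => f m + g m) := by
  obtain ⟨C, d, hC, h⟩ := hf
  obtain ⟨C', d', hC', h'⟩ := hg
  refine ⟨C + C', max d d', by positivity, fun m => ?_⟩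
  have h1 : (1 : ℝ) ≤ (m : ℝ) + 1 := by simp
  refine (norm_add_le _ _).trans ?_
  rw [add_mul]
  refine add_le_add ((h m).trans ?_) ((h' m).trans ?_) <;> gcongr <;> simp

lemma PolyBounded.nest {L : List (ℕ → ℂ)} (hL : ∀ g ∈ L, PolyBounded g) :
    PolyBounded (MultiplePolylog.nest (L.map fun g m => (‖g m‖ : ℂ))) := by
  induction L with
  | nil => exact ⟨1, 0, zero_le_one, fun m => by simp [MultiplePolylog.nest]⟩
  | cons g L ih =>
    obtain ⟨C, d, hC, h⟩ := hL g (by simp)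
    obtain ⟨C', d', hC', h'⟩ := ih fun g hg => hL g (by simp [hg])
    -- The extra degree counts the `K` summands; `2 ^ d'` absorbs the argument `m + 1` of the inner
    -- sum.
    refine ⟨C * (C' * 2 ^ d'), d + d' + 1, by positivity, fun K => ?_⟩
    rw [List.map_cons, MultiplePolylog.nest]
    have hb : ∀ m ∈ range K, ‖(‖g m‖ : ℂ) *
        MultiplePolylog.nest (L.map fun g m => (‖g m‖ : ℂ)) (m + 1)‖ ≤
        C * ((K : ℝ) + 1) ^ d * (C' * (2 ^ d' * ((K : ℝ) + 1) ^ d')) := by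
      intro m hm
      have hm' : (m : ℝ) + 1 ≤ K := by exact_mod_cast mem_range.1 hm
      rw [norm_mul, Complex.norm_real, norm_norm]
      refine mul_le_mul ((h m).trans ?_) ((h' (m + 1)).trans ?_) (norm_nonneg _) (by positivity)
      · have : (m : ℝ) ≤ K := by linarith
        gcongr
      · rw [← mul_pow]
        gcongr
        push_cast
        linarith
    refine (norm_sum_le_of_le _ hb).trans ?_
    rw [sum_const, card_range, nsmul_eq_mul]
    calc (K : ℝ) * (C * ((K : ℝ) + 1) ^ d * (C' * (2 ^ d' * ((K : ℝ) + 1) ^ d')))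
        ≤ ((K : ℝ) + 1) * (C * ((K : ℝ) + 1) ^ d * (C' * (2 ^ d' * ((K : ℝ) + 1) ^ d'))) := by
          gcongr
          linarith
      _ = _ := by ring

lemma nest_map_ofReal (L : List (ℕ → ℝ)) (K : ℕ) :
    nest (L.map fun g m => (g m : ℂ)) K = (nest L K : ℝ) := by
  induction L generalizing K with
  | nil => simp [nest]
  | cons g L ih => simp [nest, ih]

lemma nest_norm_nonneg (L : List (ℕ → ℂ)) (K : ℕ) : 0 ≤ nest (L.map fun g m => ‖g m‖) K := by
  induction L generalizing K with
  | nil => simp [nest]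
  | cons g L ih => exact sum_nonneg fun m _ => mul_nonneg (norm_nonneg _) (ih _)

lemma PolyBounded.norm_nest {L : List (ℕ → ℂ)} (hL : ∀ g ∈ L, PolyBounded g) :
    ∃ (C : ℝ) (d : ℕ), 0 ≤ C ∧
      ∀ K, MultiplePolylog.nest (L.map fun g m => ‖g m‖) K ≤ C * ((K : ℝ) + 1) ^ d := by
  obtain ⟨C, d, hC, h⟩ := PolyBounded.nest hL
  refine ⟨C, d, hC, fun K => ?_⟩
  have := h K
  rw [show (L.map fun g m => (‖g m‖ : ℂ)) =
      (L.map fun g m => ‖g m‖).map fun g m => (g m : ℂ) by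
        rw [List.map_map]; rfl, nest_map_ofReal, Complex.norm_real, Real.norm_eq_abs,
      abs_of_nonneg (nest_norm_nonneg L K)] at this
  exact this

lemma norm_nest_le (L : List (ℕ → ℂ)) (K : ℕ) :
    ‖nest L K‖ ≤ nest (L.map fun g m => ‖g m‖) K := by
  induction L generalizing K with
  | nil => simp [nest]
  | cons g L ih =>
    refine norm_sum_le_of_le _ fun m _ => ?_
    rw [norm_mul]
    exact mul_le_mul_of_nonneg_left (ih _) (norm_nonneg _)

lemma polyBounded_nest {L : List (ℕ → ℂ)} (hL : ∀ g ∈ L, PolyBounded g) :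
    PolyBounded (nest L) := by
  obtain ⟨C, d, hC, h⟩ := PolyBounded.norm_nest hL
  exact ⟨C, d, hC, fun K => (norm_nest_le L K).trans (h K)⟩

lemma summable_poly_mul_geometric (d : ℕ) {r : ℝ} (h0 : 0 ≤ r) (h1 : r < 1) :
    Summable fun m : ℕ => ((m : ℝ) + 1) ^ d * r ^ m := by
  have := summable_pow_mul_geometric_of_norm_lt_one (R := ℝ) d (r := r)
    (by rwa [Real.norm_of_nonneg h0])
  refine Summable.of_nonneg_of_le (fun m => by positivity) (fun m => ?_)
    ((this.add (summable_geometric_of_lt_one h0 h1)).mul_left (2 ^ d))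
  have h2 : ((m : ℝ) + 1) ^ d ≤ 2 ^ d * ((m : ℝ) ^ d + 1) := by
    rcases Nat.eq_zero_or_pos m with rfl | hm
    · have : (1 : ℝ) ≤ 2 ^ d := one_le_pow₀ (by norm_num)
      have h3 : (0 : ℝ) ≤ ((0 : ℕ) : ℝ) ^ d := by positivity
      simp only [Nat.cast_zero, zero_add, one_pow] at *
      nlinarith
    · have hm' : (1 : ℝ) ≤ m := by exact_mod_cast hm
      calc ((m : ℝ) + 1) ^ d ≤ (2 * m) ^ d := by gcongr; linarith
        _ = 2 ^ d * (m : ℝ) ^ d := mul_pow _ _ _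
        _ ≤ _ := by gcongr; simp
  calc ((m : ℝ) + 1) ^ d * r ^ m ≤ 2 ^ d * ((m : ℝ) ^ d + 1) * r ^ m := by gcongr
    _ = _ := by ring

/-- Geometric decay in the largest index suffices: the sum of norms over the remaining indices is a
truncated nested sum, hence polynomial in `k₁`. -/
lemma summable_prod_index {q : ℕ} {g : Fin (q + 1) → ℕ → ℂ} {f : ℕ → ℂ} {r : ℝ} (h0 : 0 ≤ r)
    (h1 : r < 1) (hf : PolyBounded f) (hg0 : ∀ m, ‖g 0 m‖ ≤ ‖f m‖ * r ^ m)
    (hg : ∀ i : Fin q, PolyBounded (g i.succ)) :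
    Summable fun k : Index (q + 1) => ∏ i, g i (k.1 i - 1) := by
  obtain ⟨C, d, hC, hCd⟩ := hf
  obtain ⟨C', d', hC', hCd'⟩ := PolyBounded.norm_nest (L := List.ofFn fun i => g i.succ)
    (by simpa [List.mem_ofFn] using hg)
  refine Summable.of_norm ?_
  have hs := (summable_poly_mul_geometric (d + d') h0 h1).mul_left (C * (C' * 2 ^ d'))
  refine summable_of_sum_le (c := ∑' m : ℕ, C * (C' * 2 ^ d') * (((m : ℝ) + 1) ^ (d + d') * r ^ m))
    (fun k => norm_nonneg _) fun u => ?_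
  obtain ⟨K, hK⟩ := ((tendsto_truncation (q + 1)).eventually (eventually_ge_atTop u)).exists
  refine (sum_le_sum_of_subset_of_nonneg hK fun _ _ _ => norm_nonneg _).trans ?_
  simp_rw [norm_prod]
  rw [sum_truncation (fun i m => ‖g i m‖) K, List.ofFn_succ, nest]
  refine le_trans (sum_le_sum fun m _ => ?_) (hs.sum_le_tsum (range K) fun m _ => by positivity)
  have h2 := hCd' (m + 1)
  rw [List.map_ofFn] at h2
  have h3 : nest (List.ofFn fun (i : Fin q) m => ‖g i.succ m‖) (m + 1) ≤
      C' * (2 ^ d' * ((m : ℝ) + 1) ^ d') := by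
    refine h2.trans ?_
    rw [← mul_pow]
    gcongr
    push_cast
    linarith [Nat.cast_nonneg (α := ℝ) m]
  calc _ ≤ (C * ((m : ℝ) + 1) ^ d * r ^ m) * (C' * (2 ^ d' * ((m : ℝ) + 1) ^ d')) := by
        refine mul_le_mul ((hg0 m).trans ?_) h3 ?_ (by positivity)
        · exact mul_le_mul_of_nonneg_right (hCd m) (by positivity)
        · have := nest_norm_nonneg (List.ofFn fun i => g i.succ) (m + 1)
          rwa [List.map_ofFn] at this
    _ = _ := by ring

lemma PolyBounded.tendsto_mul_geometric {f g : ℕ → ℂ} {r : ℝ} (h0 : 0 ≤ r) (h1 : r < 1)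
    (hf : PolyBounded f) (hg : ∀ m, ‖g m‖ ≤ r ^ m) :
    Tendsto (fun m => f m * g m) atTop (𝓝 0) := by
  obtain ⟨C, d, hC, h⟩ := hf
  have hs := ((summable_poly_mul_geometric d h0 h1).mul_left C).tendsto_atTop_zero
  refine squeeze_zero_norm (fun m => ?_) hs
  rw [norm_mul, ← mul_assoc]
  exact mul_le_mul (h m) (hg m) (norm_nonneg _) (by positivity)

/-! ### Laurent monomials and the summands. -/

variable {p : ℕ}

/-- The Laurent monomial `z ^ e`. -/
noncomputable def monomialAt (z : Fin p → ℂ) (e : Fin p → ℤ) : ℂ := ∏ j, z j ^ e j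

/-- `z ^ (-k v)` for `k = m + 1`. -/
noncomputable def decay (z : Fin p → ℂ) (v : Fin p → ℕ) (m : ℕ) : ℂ := (∏ j, z j ^ v j)⁻¹ ^ (m + 1)

/-- The summand `k ↦ f(k) z ^ (-k v)`, `k = m + 1`. -/
noncomputable def factor (z : Fin p → ℂ) (x : (ℕ → ℚ) × (Fin p → ℕ)) (m : ℕ) : ℂ := (x.1 m : ℂ) * decay z x.2 m

/-- The summand `k ↦ k ^ (-s) z ^ (-k v)`, `k = m + 1`. -/
noncomputable def pureFactor (z : Fin p → ℂ) (x : ℤ × (Fin p → ℕ)) : ℕ → ℂ := factor z (shiftedPow 0 x.1, x.2)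

lemma monomialAt_add (z : Fin p → ℂˣ) (e e' : Fin p → ℤ) :
    monomialAt (fun j => z j) (e + e') =
      monomialAt (fun j => z j) e * monomialAt (fun j => z j) e' := by
  simp [monomialAt, ← prod_mul_distrib, zpow_add₀]

lemma monomialAt_zero (z : Fin p → ℂ) : monomialAt z 0 = 1 := by simp [monomialAt]

lemma monomialAt_natCast (z : Fin p → ℂ) (v : Fin p → ℕ) :
    monomialAt z (fun j => v j) = ∏ j, z j ^ v j := by simp [monomialAt]

lemma monomialAt_neg_natCast (z : Fin p → ℂ) (v : Fin p → ℕ) :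
    monomialAt z (fun j => -(v j : ℤ)) = (∏ j, z j ^ v j)⁻¹ := by
  simp [monomialAt]

lemma decay_add (z : Fin p → ℂ) (v w : Fin p → ℕ) (m : ℕ) :
    decay z (v + w) m = decay z v m * decay z w m := by
  simp only [decay, Pi.add_apply, pow_add _ (v _), prod_mul_distrib, mul_inv, mul_pow]

lemma decay_succ (z : Fin p → ℂˣ) (v : Fin p → ℕ) (m : ℕ) :
    monomialAt (fun j => z j) (fun j => v j) * decay (fun j => z j) v (m + 1) =
      decay (fun j => z j) v m := by
  have : (∏ j, (z j : ℂ) ^ v j) ≠ 0 := prod_ne_zero_iff.2 fun j _ => by simp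
  rw [monomialAt_natCast, decay, decay, pow_succ' _ (m + 1), ← mul_assoc, mul_inv_cancel₀ this,
    one_mul]

lemma decay_succ' (z : Fin p → ℂ) (v : Fin p → ℕ) (m : ℕ) :
    decay z v (m + 1) = monomialAt z (fun j => -(v j : ℤ)) * decay z v m := by
  rw [monomialAt_neg_natCast, decay, decay, pow_succ' _ (m + 1)]

/-! ### Spans of truncated polylogarithms and boundary terms. -/

/-- The weight `∑ max(sᵢ, 0)` of a list of exponents. -/
def listWeight (L : List (ℤ × (Fin p → ℕ))) : ℕ := (L.map fun x => x.1.toNat).sum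

/-- The sum of the exponent vectors. -/
def listTotal (L : List (ℤ × (Fin p → ℕ))) : Fin p → ℕ := (L.map Prod.snd).sum

/-- Lists with nonzero exponent vectors, of length at most `d`, weight at most `W` and total at
most `τ`. -/
structure Admissible (L : List (ℤ × (Fin p → ℕ))) (d W : ℕ) (τ : Fin p → ℕ) : Prop where
  ne_zero : ∀ x ∈ L, x.2 ≠ 0
  length_le : L.length ≤ d
  weight_le : listWeight L ≤ W
  total_le : listTotal L ≤ τ

/-- The functions `z ^ e T(K)`, where `T` is a truncated multiple polylogarithm whose first
exponent vector is at least `v`. -/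
def polylogGen (d W : ℕ) (τ v : Fin p → ℕ) : Set ((Fin p → ℂˣ) → ℕ → ℂ) :=
  {F | ∃ (e : Fin p → ℤ) (L : List (ℤ × (Fin p → ℕ))), Admissible L d W τ ∧
    (∀ x ∈ L.head?, v ≤ x.2) ∧
    F = fun z K => monomialAt (fun j => z j) e * nest (L.map (pureFactor fun j => z j)) K}

/-- The boundary terms `z ^ e f(K + 1) z ^ (-(K + 1) u) T(K)` with `T` a truncated multiple
polylogarithm and `u ≥ v`. -/
def boundaryGen (d W : ℕ) (τ v : Fin p → ℕ) : Set ((Fin p → ℂˣ) → ℕ → ℂ) :=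
  {F | ∃ (e : Fin p → ℤ) (a W' d' : ℕ) (f : ℕ → ℚ) (u τ' : Fin p → ℕ)
    (L : List (ℤ × (Fin p → ℕ))),
    f ∈ polar a ∧ v ≤ u ∧ u ≠ 0 ∧ Admissible L d' W' τ' ∧ d' + 1 ≤ d ∧ a + W' ≤ W ∧ u + τ' ≤ τ ∧
    F = fun z K => monomialAt (fun j => z j) e *
      (factor (fun j => z j) (f, u) K * nest (L.map (pureFactor fun j => z j)) K)}

/-- The span of truncated multiple polylogarithms and boundary terms. -/
noncomputable def nestSpan (d W : ℕ) (τ v : Fin p → ℕ) : Submodule ℚ ((Fin p → ℂˣ) → ℕ → ℂ) :=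
  Submodule.span ℚ (polylogGen d W τ v ∪ boundaryGen d W τ v)

lemma Admissible.mono {L : List (ℤ × (Fin p → ℕ))} {d W d' W' : ℕ} {τ τ' : Fin p → ℕ}
    (h : Admissible L d W τ) (hd : d ≤ d') (hW : W ≤ W') (hτ : τ ≤ τ') : Admissible L d' W' τ' :=
  ⟨h.1, h.2.trans hd, h.3.trans hW, h.4.trans hτ⟩

lemma nestSpan_mono {d W d' W' : ℕ} {τ τ' v v' : Fin p → ℕ} (hd : d ≤ d') (hW : W ≤ W')
    (hτ : τ ≤ τ') (hv : v' ≤ v) : nestSpan d W τ v ≤ nestSpan d' W' τ' v' := by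
  refine Submodule.span_mono (Set.union_subset_union ?_ ?_)
  · rintro F ⟨e, L, h, hL, rfl⟩
    exact ⟨e, L, h.mono hd hW hτ, fun x hx => hv.trans (hL x hx), rfl⟩
  · rintro F ⟨e, a, W₁, d₁, f, u, τ₁, L, hf, hu, hu0, h, h1, h2, h3, rfl⟩
    exact ⟨e, a, W₁, d₁, f, u, τ₁, L, hf, hv.trans hu, hu0, h, h1.trans hd, h2.trans hW,
      h3.trans hτ, rfl⟩

/-- Multiplication by a Laurent monomial. -/
noncomputable def mulMonomial (e : Fin p → ℤ) :
    ((Fin p → ℂˣ) → ℕ → ℂ) →ₗ[ℚ] ((Fin p → ℂˣ) → ℕ → ℂ) where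
  toFun F := fun z K => monomialAt (fun j => z j) e * F z K
  map_add' F G := by ext z K; simp [mul_add]
  map_smul' c F := by ext z K; simp

lemma mulMonomial_mem {d W : ℕ} {τ v : Fin p → ℕ} (e : Fin p → ℤ) {F : (Fin p → ℂˣ) → ℕ → ℂ}
    (hF : F ∈ nestSpan d W τ v) : mulMonomial e F ∈ nestSpan d W τ v := by
  have : nestSpan d W τ v ≤ (nestSpan d W τ v).comap (mulMonomial e) := by
    refine Submodule.span_le.2 ?_
    rintro F (⟨e', L, h, hL, rfl⟩ | ⟨e', a, W₁, d₁, f, u, τ₁, L, hf, hu, hu0, h, h1, h2, h3, rfl⟩)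
    · refine Submodule.subset_span (Or.inl ⟨e + e', L, h, hL, ?_⟩)
      ext z K
      simp [mulMonomial, monomialAt_add, mul_assoc]
    · refine Submodule.subset_span (Or.inr ⟨e + e', a, W₁, d₁, f, u, τ₁, L, hf, hu, hu0, h, h1, h2,
        h3, ?_⟩)
      ext z K
      simp [mulMonomial, monomialAt_add, mul_assoc]
  exact this hF

/-! ### Summation by parts and removal of shifts. -/

/-- `∑_{k ≤ K} f(k) z ^ (-k v) F(k)`. -/
noncomputable def sumOp (v : Fin p → ℕ) :
    (ℕ → ℚ) →ₗ[ℚ] ((Fin p → ℂˣ) → ℕ → ℂ) →ₗ[ℚ] ((Fin p → ℂˣ) → ℕ → ℂ) :=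
  LinearMap.mk₂ ℚ
    (fun f F z K => ∑ m ∈ range K, factor (fun j => z j) (f, v) m * F z (m + 1))
    (fun f g F => by ext z K; simp [factor, add_mul, sum_add_distrib])
    (fun c f F => by ext z K; simp [factor, mul_sum, mul_assoc, Rat.smul_def])
    (fun f F G => by ext z K; simp [mul_add, sum_add_distrib])
    (fun c f F => by
      ext z K
      simp only [Pi.smul_apply, Rat.smul_def, mul_sum]
      exact sum_congr rfl fun m _ => by ring)

lemma sumOp_apply (v : Fin p → ℕ) (f : ℕ → ℚ) (F : (Fin p → ℂˣ) → ℕ → ℂ) (z : Fin p → ℂˣ)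
    (K : ℕ) :
    sumOp v f F z K = ∑ m ∈ range K, factor (fun j => z j) (f, v) m * F z (m + 1) := rfl

/-- The truncated multiple polylogarithm attached to a list. -/
noncomputable def pureNest (L : List (ℤ × (Fin p → ℕ))) (z : Fin p → ℂˣ) (K : ℕ) : ℂ :=
  nest (L.map (pureFactor fun j => z j)) K

lemma pureNest_cons (x : ℤ × (Fin p → ℕ)) (L : List (ℤ × (Fin p → ℕ))) :
    pureNest (x :: L) = sumOp x.2 (shiftedPow 0 x.1) (pureNest L) := rfl

lemma factor_mul (z : Fin p → ℂ) (f g : ℕ → ℚ) (v w : Fin p → ℕ) (m : ℕ) :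
    factor z (f, v) m * factor z (g, w) m = factor z (f * g, v + w) m := by
  simp [factor, decay_add]
  ring

lemma factor_shiftedPow_succ (z : Fin p → ℂˣ) (i : ℕ) (s : ℤ) (v : Fin p → ℕ) (m : ℕ) :
    factor (fun j => z j) (shiftedPow (i + 1) s, v) m =
      monomialAt (fun j => z j) (fun j => v j) *
        factor (fun j => z j) (shiftedPow i s, v) (m + 1) := by
  simp only [factor]
  rw [mul_left_comm, decay_succ]
  congr 2
  simp only [shiftedPow]
  push_cast
  ring_nf

/-- Summation by parts, lowering the shift by one. -/
lemma sumOp_shiftedPow_succ_nil (i : ℕ) (s : ℤ) (v : Fin p → ℕ) :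
    sumOp v (shiftedPow (i + 1) s) (pureNest []) =
      mulMonomial (fun j => v j) (sumOp v (shiftedPow i s) (pureNest []) +
        (fun z K => factor (fun j => z j) (shiftedPow i s, v) K * pureNest [] z K)) -
      shiftedPow i s 0 • (pureNest []) := by
  ext z K
  have h1 := sum_range_succ' (factor (fun j => (z j : ℂ)) (shiftedPow i s, v)) K
  rw [sum_range_succ] at h1
  simp only [mulMonomial, LinearMap.coe_mk, AddHom.coe_mk, Pi.sub_apply, Pi.add_apply,
    Pi.smul_apply, sumOp_apply, pureNest, nest, List.map_nil, mul_one, factor_shiftedPow_succ,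
    ← mul_sum]
  rw [h1, mul_add]
  have h2 : monomialAt (fun j => (z j : ℂ)) (fun j => v j) *
      factor (fun j => (z j : ℂ)) (shiftedPow i s, v) 0 = shiftedPow i s 0 := by
    have : (∏ j, (z j : ℂ) ^ v j) ≠ 0 := prod_ne_zero_iff.2 fun j _ => by simp
    rw [factor, decay, monomialAt_natCast, zero_add, pow_one]
    field_simp
  rw [h2, Rat.smul_def]
  ring

/-- Reindexing replaces `T(k)` by `T(k - 1)`; their difference is the top summand of `T`, where the
two outer variables coincide. This gives the merged term, with vector `v + x.2` and one level less
of nesting. -/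
lemma sumOp_shiftedPow_succ_cons (i : ℕ) (s : ℤ) (v : Fin p → ℕ) (x : ℤ × (Fin p → ℕ))
    (L : List (ℤ × (Fin p → ℕ))) :
    sumOp v (shiftedPow (i + 1) s) (pureNest (x :: L)) =
      mulMonomial (fun j => v j) (sumOp v (shiftedPow i s) (pureNest (x :: L)) -
        sumOp (v + x.2) (shiftedPow i s * shiftedPow 0 x.1) (pureNest L) +
        (fun z K => factor (fun j => z j) (shiftedPow i s, v) K * pureNest (x :: L) z K)) := by
  ext z K
  have h1 := sum_range_succ' (fun m => factor (fun j => (z j : ℂ)) (shiftedPow i s, v) m *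
    pureNest (x :: L) z m) K
  -- A nonempty nested sum is empty at `K = 0`, so the constant of the depth-zero case does not
  -- arise.
  have h0 : pureNest (x :: L) z 0 = 0 := by simp [pureNest, nest]
  rw [sum_range_succ, h0, mul_zero, add_zero] at h1
  have h2 : ∀ m, pureNest (x :: L) z (m + 1) = pureNest (x :: L) z m +
      pureFactor (fun j => z j) x m * pureNest L z (m + 1) := fun m => by
    simp [pureNest, nest, sum_range_succ]
  simp only [mulMonomial, LinearMap.coe_mk, AddHom.coe_mk, Pi.sub_apply, Pi.add_apply,
    sumOp_apply, factor_shiftedPow_succ, mul_assoc, ← mul_sum]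
  rw [← h1, ← sum_sub_distrib]
  congr 2
  refine sum_congr rfl fun m _ => ?_
  rw [h2, ← factor_mul, pureFactor]
  ring

lemma Admissible.self {L : List (ℤ × (Fin p → ℕ))} (h : ∀ x ∈ L, x.2 ≠ 0) :
    Admissible L L.length (listWeight L) (listTotal L) := ⟨h, le_rfl, le_rfl, le_rfl⟩

lemma pureNest_mem {d W : ℕ} {τ v : Fin p → ℕ} {L : List (ℤ × (Fin p → ℕ))}
    (h : Admissible L d W τ) (hv : ∀ x ∈ L.head?, v ≤ x.2) : pureNest L ∈ nestSpan d W τ v := by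
  refine Submodule.subset_span (Or.inl ⟨0, L, h, hv, ?_⟩)
  ext z K
  simp [monomialAt_zero, pureNest]

lemma listWeight_cons (x : ℤ × (Fin p → ℕ)) (L : List (ℤ × (Fin p → ℕ))) :
    listWeight (x :: L) = x.1.toNat + listWeight L := by simp [listWeight]

lemma listTotal_cons (x : ℤ × (Fin p → ℕ)) (L : List (ℤ × (Fin p → ℕ))) :
    listTotal (x :: L) = x.2 + listTotal L := by simp [listTotal]

lemma boundary_mem {a : ℕ} {f : ℕ → ℚ} (hf : f ∈ polar a) {v : Fin p → ℕ} (hv : v ≠ 0)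
    {L : List (ℤ × (Fin p → ℕ))} (h : ∀ x ∈ L, x.2 ≠ 0) :
    (fun z K => factor (fun j => z j) (f, v) K * pureNest L z K) ∈
      nestSpan (L.length + 1) (a + listWeight L) (v + listTotal L) v := by
  refine Submodule.subset_span (Or.inr ⟨0, a, _, _, f, v, _, L, hf, le_rfl, hv,
    Admissible.self h, le_rfl, le_rfl, le_rfl, ?_⟩)
  ext z K
  simp [monomialAt_zero, pureNest]

/-- Outer induction on depth, inner induction on the shift. Since `f`, `a` and `v` vary, the outer
hypothesis covers the merged term, whose coefficient is a product with two poles. -/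
lemma sumOp_pureNest_mem {L : List (ℤ × (Fin p → ℕ))} (hL : ∀ x ∈ L, x.2 ≠ 0) {a : ℕ}
    {f : ℕ → ℚ} (hf : f ∈ polar a) {v : Fin p → ℕ} (hv : v ≠ 0) :
    sumOp v f (pureNest L) ∈
      nestSpan (L.length + 1) (a + listWeight L) (v + listTotal L) v := by
  induction L generalizing a f v with
  | nil =>
    have : polar a ≤ (nestSpan (([] : List (ℤ × (Fin p → ℕ))).length + 1)
        (a + listWeight ([] : List (ℤ × (Fin p → ℕ)))) (v + listTotal []) v).comap ((sumOp v).flip (pureNest [])) := by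
      refine Submodule.span_le.2 ?_
      rintro f ⟨i, s, hs, rfl⟩
      rw [SetLike.mem_coe, Submodule.mem_comap, LinearMap.flip_apply]
      induction i with
      | zero =>
        rw [← pureNest_cons (s, v)]
        refine pureNest_mem ⟨by simpa using hv, by simp, ?_, ?_⟩ (by simp)
        · rw [listWeight_cons]
          gcongr
          simpa using hs
        · rw [listTotal_cons]
      | succ i ih =>
        rw [sumOp_shiftedPow_succ_nil]
        refine sub_mem (mulMonomial_mem _ (add_mem ih ?_)) (Submodule.smul_mem _ _ ?_)
        · exact boundary_mem (shiftedPow_mem i hs) hv (by simp)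
        -- The constant is a depth-zero polylogarithm; having no head, it satisfies the condition on
        -- the first vector vacuously.
        · exact pureNest_mem ⟨by simp, by simp, by simp [listWeight], by simp [listTotal]⟩ (by simp)
    exact this hf
  | cons x L ihL =>
    have hx : x.2 ≠ 0 := hL x (by simp)
    have hL' : ∀ y ∈ L, y.2 ≠ 0 := fun y hy => hL y (by simp [hy])
    have : polar a ≤ (nestSpan ((x :: L).length + 1) (a + listWeight (x :: L))
        (v + listTotal (x :: L)) v).comap ((sumOp v).flip (pureNest (x :: L))) := by
      refine Submodule.span_le.2 ?_
      rintro f ⟨i, s, hs, rfl⟩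
      rw [SetLike.mem_coe, Submodule.mem_comap, LinearMap.flip_apply]
      induction i with
      | zero =>
        rw [← pureNest_cons (s, v)]
        refine pureNest_mem ⟨?_, by simp, ?_, ?_⟩ (by simp)
        · intro y hy
          rcases List.mem_cons.1 hy with rfl | hy
          exacts [hv, hL y hy]
        · rw [listWeight_cons]
          gcongr
          simpa using hs
        · rw [listTotal_cons]
      | succ i ih =>
        rw [sumOp_shiftedPow_succ_cons]
        refine mulMonomial_mem _ (add_mem (sub_mem ih ?_) ?_)
        · have h1 := ihL hL' (polar_mul (shiftedPow_mem i hs)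
            (shiftedPow_mem 0 (Int.self_le_toNat x.1))) (v := v + x.2) (by
              intro h
              exact hv (by simpa using (add_eq_zero.1 h).1))
          refine nestSpan_mono (by simp) ?_ ?_ (by simp) h1
          · rw [listWeight_cons, add_assoc]
          · rw [listTotal_cons, add_assoc]
        · exact boundary_mem (shiftedPow_mem i hs) hv hL
    exact this hf

lemma sumOp_mem {d W a : ℕ} {τ : Fin p → ℕ} {F : (Fin p → ℂˣ) → ℕ → ℂ}
    (hF : F ∈ nestSpan d W τ 0) {f : ℕ → ℚ} (hf : f ∈ polar a) {v : Fin p → ℕ} (hv : v ≠ 0) :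
    sumOp v f F ∈ nestSpan (d + 1) (a + W) (v + τ) v := by
  have hcomm : ∀ e (G : (Fin p → ℂˣ) → ℕ → ℂ) (u : Fin p → ℕ) (g : ℕ → ℚ),
      sumOp u g (mulMonomial e G) = mulMonomial e (sumOp u g G) := by
    intro e G u g
    ext z K
    simp only [sumOp_apply, mulMonomial, LinearMap.coe_mk, AddHom.coe_mk, mul_sum]
    exact sum_congr rfl fun m _ => by ring
  have : nestSpan d W τ 0 ≤ (nestSpan (d + 1) (a + W) (v + τ) v).comap (sumOp v f) := by
    refine Submodule.span_le.2 ?_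
    rintro F (⟨e', L, h, hL, rfl⟩ | ⟨e', b, W₁, d₁, g, u, τ₁, L, hg, hu, hu0, h, h1, h2, h3, rfl⟩)
    · rw [SetLike.mem_coe, Submodule.mem_comap]
      change sumOp v f (mulMonomial e' (pureNest L)) ∈ nestSpan (d + 1) (a + W) (v + τ) v
      rw [hcomm]
      refine mulMonomial_mem _ (nestSpan_mono ?_ ?_ ?_ le_rfl (sumOp_pureNest_mem h.1 hf hv))
      · exact Nat.succ_le_succ h.2
      · exact Nat.add_le_add_left h.3 _
      · exact add_le_add_right h.4 _
    -- A boundary term of the inner sum involves `k + 1`. The factor `z ^ (-(k + 1) u)` splits into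
    -- `z ^ (-u)`, which leaves the sum, and `z ^ (-k u)`, which merges with `z ^ (-k v)`.
    · have key : sumOp v f (fun z K => monomialAt (fun j => (z j : ℂ)) e' *
          (factor (fun j => (z j : ℂ)) (g, u) K * nest (L.map (pureFactor fun j => (z j : ℂ))) K)) =
          mulMonomial (e' + fun j => -(u j : ℤ))
            (sumOp (v + u) (f * fun m => g (m + 1)) (pureNest L)) := by
        ext z K
        simp only [sumOp_apply, mulMonomial, LinearMap.coe_mk, AddHom.coe_mk, mul_sum,
          monomialAt_add, ← factor_mul, pureNest]
        refine sum_congr rfl fun m _ => ?_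
        simp only [factor, decay_succ']
        ring
      rw [SetLike.mem_coe, Submodule.mem_comap, key]
      refine mulMonomial_mem _ (nestSpan_mono ?_ ?_ ?_ ?_
        (sumOp_pureNest_mem h.1 (polar_mul hf (polar_shift hg)) (v := v + u) ?_))
      · have := h.2
        omega
      · have := h.3
        omega
      · rw [add_assoc]
        exact add_le_add_right ((add_le_add_right h.4 _).trans h3) _
      · simp
      · intro h
        exact hv (by simpa using (add_eq_zero.1 h).1)
  exact this hF

lemma nest_mem_succ {q : ℕ} {f : Fin (q + 1) → ℕ → ℚ} {a : Fin (q + 1) → ℕ}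
    {v : Fin (q + 1) → Fin p → ℕ} (hf : f 0 ∈ polar (a 0)) (hv : v 0 ≠ 0)
    (h : (fun (z : Fin p → ℂˣ) K =>
        nest (List.ofFn fun i : Fin q => factor (fun j => z j) (f i.succ, v i.succ)) K) ∈
      nestSpan q (∑ i : Fin q, a i.succ) (∑ i : Fin q, v i.succ) 0) :
    (fun (z : Fin p → ℂˣ) K => nest (List.ofFn fun i => factor (fun j => z j) (f i, v i)) K) ∈
      nestSpan (q + 1) (∑ i, a i) (∑ i, v i) (v 0) := by
  have := sumOp_mem h hf hv
  rw [← Fin.sum_univ_succ, ← Fin.sum_univ_succ] at this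
  convert this using 1
  ext z K
  rw [List.ofFn_succ]
  rfl

lemma nest_mem {q : ℕ} (f : Fin q → ℕ → ℚ) (a : Fin q → ℕ) (v : Fin q → Fin p → ℕ)
    (hf : ∀ i, f i ∈ polar (a i)) (hv : ∀ i, v i ≠ 0) :
    (fun (z : Fin p → ℂˣ) K => nest (List.ofFn fun i => factor (fun j => z j) (f i, v i)) K) ∈
      nestSpan q (∑ i, a i) (∑ i, v i) 0 := by
  induction q with
  | zero =>
    have := pureNest_mem (p := p) (d := 0) (W := ∑ i, a i) (τ := ∑ i, v i) (v := 0) (L := [])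
      ⟨by simp, by simp, by simp [listWeight], by simp [listTotal]⟩ (by simp)
    simp only [List.ofFn_zero]
    exact this
  | succ q ih =>
    exact nestSpan_mono le_rfl le_rfl le_rfl (by simp) (nest_mem_succ (hf 0) (hv 0)
      (ih _ _ _ (fun i => hf i.succ) (fun i => hv i.succ)))

/-! ### Estimates on the domain. -/

lemma polyBounded_of_mem_polar {a : ℕ} {f : ℕ → ℚ} (hf : f ∈ polar a) :
    PolyBounded fun m => (f m : ℂ) := by
  induction hf using Submodule.span_induction with
  | mem f hf =>
    obtain ⟨i, s, -, rfl⟩ := hf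
    refine ⟨((i : ℝ) + 1) ^ s.natAbs, s.natAbs, by positivity, fun m => ?_⟩
    have h1 : (1 : ℝ) ≤ (m : ℝ) + 1 + i := by
      have : (0 : ℝ) ≤ (m : ℝ) + i := by positivity
      linarith
    have h2 : (m : ℝ) + 1 + i ≤ ((i : ℝ) + 1) * ((m : ℝ) + 1) := by
      have : (0 : ℝ) ≤ (i : ℝ) * m := by positivity
      linarith
    have h3 : ‖((shiftedPow i s m : ℚ) : ℂ)‖ = ((m : ℝ) + 1 + i) ^ (-s) := by
      rw [shiftedPow]
      push_cast
      rw [norm_zpow]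
      congr 1
      rw [show (m : ℂ) + 1 + i = ((m + 1 + i : ℕ) : ℂ) by push_cast; ring, Complex.norm_natCast]
      push_cast
      ring
    rw [h3, ← mul_pow]
    calc ((m : ℝ) + 1 + i) ^ (-s) ≤ ((m : ℝ) + 1 + i) ^ (s.natAbs : ℤ) :=
          zpow_le_zpow_right₀ h1 (by omega)
      _ = ((m : ℝ) + 1 + i) ^ s.natAbs := zpow_natCast _ _
      _ ≤ _ := by gcongr
  | zero => exact ⟨0, 0, le_rfl, fun m => by simp⟩
  | add f g _ _ hf hg => simpa using hf.add hg
  | smul c f _ hf =>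
    have hc : PolyBounded fun _ => (c : ℂ) := ⟨‖(c : ℂ)‖, 0, norm_nonneg _, fun m => by simp⟩
    simpa using hc.mul hf

/-- The domain `|z_{j₀}| > 1`, `|z_j| ≥ 1`. -/
def InDomain (j₀ : Fin p) (z : Fin p → ℂ) : Prop := 1 < ‖z j₀‖ ∧ ∀ j, 1 ≤ ‖z j‖

lemma one_le_prod_of_forall {f : Fin p → ℝ} {s : Finset (Fin p)} (h : ∀ j ∈ s, 1 ≤ f j) :
    1 ≤ ∏ j ∈ s, f j := by
  simpa using prod_le_prod (fun _ _ => zero_le_one) h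

lemma norm_decay_le_one {j₀ : Fin p} {z : Fin p → ℂ} (hz : InDomain j₀ z) (v : Fin p → ℕ)
    (m : ℕ) : ‖decay z v m‖ ≤ 1 := by
  rw [decay, norm_pow, norm_inv, norm_prod]
  refine pow_le_one₀ (by positivity) (inv_le_one_of_one_le₀ ?_)
  refine one_le_prod_of_forall fun j _ => ?_
  rw [norm_pow]
  exact one_le_pow₀ (hz.2 j)

lemma norm_decay_le_pow {j₀ : Fin p} {z : Fin p → ℂ} (hz : InDomain j₀ z) {v : Fin p → ℕ}
    (hv : 1 ≤ v j₀) (m : ℕ) : ‖decay z v m‖ ≤ ‖z j₀‖⁻¹ ^ m := by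
  rw [decay, norm_pow, norm_inv, norm_prod]
  have h0 : 0 < ‖z j₀‖ := zero_lt_one.trans hz.1
  have h1 : ‖z j₀‖ ≤ ∏ j, ‖z j ^ v j‖ := by
    rw [← mul_prod_erase univ _ (mem_univ j₀)]
    have h2 : ‖z j₀‖ ≤ ‖z j₀ ^ v j₀‖ := by
      rw [norm_pow]
      exact le_self_pow₀ hz.1.le (by omega)
    refine h2.trans (le_mul_of_one_le_right (norm_nonneg _) (one_le_prod_of_forall fun j _ => ?_))
    rw [norm_pow]
    exact one_le_pow₀ (hz.2 j)
  calc (∏ j, ‖z j ^ v j‖)⁻¹ ^ (m + 1) ≤ ‖z j₀‖⁻¹ ^ (m + 1) := by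
        have := h0.trans_le h1
        gcongr
    _ ≤ ‖z j₀‖⁻¹ ^ m :=
        pow_le_pow_of_le_one (by positivity) (inv_le_one_of_one_le₀ hz.1.le) (Nat.le_succ m)

lemma polyBounded_factor {j₀ : Fin p} {z : Fin p → ℂ} (hz : InDomain j₀ z)
    {x : (ℕ → ℚ) × (Fin p → ℕ)} (hx : PolyBounded fun m => (x.1 m : ℂ)) :
    PolyBounded (factor z x) := by
  refine hx.mul ⟨1, 0, zero_le_one, fun m => ?_⟩
  simpa using norm_decay_le_one hz x.2 m

lemma summable_prod_factor {j₀ : Fin p} {z : Fin p → ℂ} (hz : InDomain j₀ z) {q : ℕ}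
    {g : Fin q → (ℕ → ℚ) × (Fin p → ℕ)} (hg : ∀ i, PolyBounded fun m => ((g i).1 m : ℂ))
    (h0 : ∀ i : Fin q, i.val = 0 → 1 ≤ (g i).2 j₀) :
    Summable fun k : Index q => ∏ i, factor z (g i) (k.1 i - 1) := by
  cases q with
  | zero => exact Summable.of_finite
  | succ q =>
    refine summable_prod_index (g := fun i => factor z (g i)) (r := ‖z j₀‖⁻¹) (by positivity)
      (inv_lt_one_of_one_lt₀ hz.1) (hg 0) (fun m => ?_) fun i => polyBounded_factor hz (hg _)
    rw [factor, norm_mul]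
    exact mul_le_mul_of_nonneg_left (norm_decay_le_pow hz (h0 0 rfl) m) (norm_nonneg _)

/-! ### Passage to the limit. -/

/-- The functions `z ^ e La_s(1 / ẑ)` of depth at most `d` and weight at most `W` whose series
converge absolutely on the domain. -/
def laGen (j₀ : Fin p) (d W : ℕ) : Set ((Fin p → ℂˣ) → ℂ) :=
  {Φ | ∃ (e : Fin p → ℤ) (q : ℕ) (s : Fin q → ℤ) (S : Fin q → Finset (Fin p)),
    q ≤ d ∧ weight s ≤ W ∧ (∀ i, (S i).Nonempty) ∧
    (∀ z : Fin p → ℂ, InDomain j₀ z → Summable (laTerm s fun i => 1 / ∏ j ∈ S i, z j)) ∧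
    Φ = fun z => monomialAt (fun j => z j) e * La s fun i => 1 / ∏ j ∈ S i, (z j : ℂ)}

lemma laTerm_eq_prod_pureFactor {q : ℕ} (x : Fin q → ℤ × (Fin p → ℕ)) (hx : ∀ i, (x i).2 ≤ 1)
    (z : Fin p → ℂ) (k : Index q) :
    laTerm (fun i => (x i).1) (fun i => 1 / ∏ j with (x i).2 j = 1, z j) k =
      ∏ i, pureFactor z (x i) (k.1 i - 1) := by
  refine prod_congr rfl fun i _ => ?_
  have hk := Nat.sub_add_cancel (k.2.2 i)
  have hk' : ((k.1 i - 1 : ℕ) : ℂ) + 1 = k.1 i := by exact_mod_cast congrArg (Nat.cast (R := ℂ)) hk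
  have hS : ∏ j with (x i).2 j = 1, z j = ∏ j, z j ^ (x i).2 j := by
    rw [prod_filter]
    refine prod_congr rfl fun j _ => ?_
    have : (x i).2 j ≤ 1 := hx i j
    interval_cases (x i).2 j <;> simp
  simp only [pureFactor, factor, decay, shiftedPow]
  push_cast
  rw [hk, hk', hS, one_div, add_zero, zpow_neg, div_eq_mul_inv, mul_comm]

lemma le_listTotal {L : List (ℤ × (Fin p → ℕ))} {x : ℤ × (Fin p → ℕ)} (hx : x ∈ L) :
    x.2 ≤ listTotal L := List.single_le_sum (by simp) _ (List.mem_map_of_mem hx)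

/-- Total at most `1` makes each vector the indicator of a set, nonempty because the vector is
nonzero. The head dominates the `j₀`-th basis vector, which supplies the geometric decay. -/
lemma exists_tendsto_pureNest {j₀ : Fin p} {d W : ℕ} {L : List (ℤ × (Fin p → ℕ))}
    (h : Admissible L d W 1) (hL : ∀ x ∈ L.head?, Pi.single j₀ 1 ≤ x.2) :
    ∃ (q : ℕ) (s : Fin q → ℤ) (S : Fin q → Finset (Fin p)),
      q ≤ d ∧ weight s ≤ W ∧ (∀ i, (S i).Nonempty) ∧
      ∀ z : Fin p → ℂ, InDomain j₀ z → Summable (laTerm s fun i => 1 / ∏ j ∈ S i, z j) ∧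
        Tendsto (nest (L.map (pureFactor z))) atTop (𝓝 (La s fun i => 1 / ∏ j ∈ S i, z j)) := by
  have hle : ∀ i, (L.get i).2 ≤ 1 := fun i => (le_listTotal (L.get_mem i)).trans h.total_le
  refine ⟨L.length, fun i => (L.get i).1, fun i => univ.filter fun j => (L.get i).2 j = 1,
    h.length_le, ?_, fun i => ?_, fun z hz => ?_⟩
  · have h1 : weight (fun i => (L.get i).1) = (listWeight L : ℤ) := by
      rw [listWeight, ← Fin.sum_univ_fun_getElem]
      push_cast
      refine sum_congr rfl fun i _ => ?_
      simp
    rw [h1]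
    exact_mod_cast h.weight_le
  · obtain ⟨j, hj⟩ := Function.ne_iff.1 (h.ne_zero _ (L.get_mem i))
    have h1 : (L.get i).2 j ≤ 1 := hle i j
    have h2 : (L.get i).2 j ≠ 0 := hj
    exact ⟨j, by simp only [mem_filter, mem_univ, true_and]; omega⟩
  · have hs : Summable fun k : Index L.length => ∏ i, pureFactor z (L.get i) (k.1 i - 1) := by
      refine summable_prod_factor hz (g := fun i => (shiftedPow 0 (L.get i).1, (L.get i).2))
        (fun i => polyBounded_of_mem_polar (shiftedPow_mem 0 (Int.self_le_toNat _))) fun i hi => ?_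
      have h1 : L.get i ∈ L.head? := by
        rw [List.head?_eq_getElem?, ← hi]
        simp
      simpa using hL _ h1 j₀
    have hT := funext (laTerm_eq_prod_pureFactor L.get hle z)
    refine ⟨by rw [hT]; exact hs, ?_⟩
    rw [La, hT]
    have h2 := tendsto_nest (g := fun i => pureFactor z (L.get i)) hs
    rwa [show (List.ofFn fun i => pureFactor z (L.get i)) = L.map (pureFactor z) by
      conv_rhs => rw [← List.ofFn_get L, List.map_ofFn]
      rfl] at h2

/-- Boundary terms contribute nothing: `u` contains `j₀`, so the geometric factor beats the
polynomial growth of the rest. -/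
lemma exists_tendsto_of_mem_nestSpan {j₀ : Fin p} {d W : ℕ} {F : (Fin p → ℂˣ) → ℕ → ℂ}
    (hF : F ∈ nestSpan d W 1 (Pi.single j₀ 1)) :
    ∃ Φ ∈ Submodule.span ℚ (laGen j₀ d W), ∀ z : Fin p → ℂˣ, InDomain j₀ (fun j => z j) →
      Tendsto (F z) atTop (𝓝 (Φ z)) := by
  induction hF using Submodule.span_induction with
  | mem F hF =>
    rcases hF with ⟨e, L, h, hL, rfl⟩ | ⟨e, a, W', d', f, u, τ, L, hf, hu, -, h, -, -, -, rfl⟩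
    · obtain ⟨q, s, S, hq, hw, hS, H⟩ := exists_tendsto_pureNest h hL
      exact ⟨_, Submodule.subset_span ⟨e, q, s, S, hq, hw, hS, fun z hz => (H z hz).1, rfl⟩,
        fun z hz => (H _ hz).2.const_mul _⟩
    · refine ⟨0, zero_mem _, fun z hz => ?_⟩
      have h1 : PolyBounded (nest (L.map (pureFactor fun j => (z j : ℂ)))) := by
        refine polyBounded_nest fun g hg => ?_
        obtain ⟨x, -, rfl⟩ := List.mem_map.1 hg
        exact polyBounded_factor hz
          (polyBounded_of_mem_polar (shiftedPow_mem 0 (Int.self_le_toNat _)))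
      have h2 := ((polyBounded_of_mem_polar hf).mul h1).tendsto_mul_geometric
        (r := ‖(z j₀ : ℂ)‖⁻¹) (by positivity) (inv_lt_one_of_one_lt₀ hz.1)
        (norm_decay_le_pow hz (v := u) (by simpa using hu j₀))
      have h3 := h2.const_mul (monomialAt (fun j => (z j : ℂ)) e)
      rw [mul_zero] at h3
      refine h3.congr fun K => ?_
      simp only [factor]
      ring
  | zero => exact ⟨0, zero_mem _, fun z _ => tendsto_const_nhds⟩
  | add F G _ _ hF hG =>
    obtain ⟨Φ, hΦ, H⟩ := hF
    obtain ⟨Ψ, hΨ, H'⟩ := hG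
    exact ⟨Φ + Ψ, add_mem hΦ hΨ, fun z hz => (H z hz).add (H' z hz)⟩
  | smul c F _ hF =>
    obtain ⟨Φ, hΦ, H⟩ := hF
    exact ⟨c • Φ, Submodule.smul_mem _ _ hΦ, fun z hz => (H z hz).const_smul c⟩

lemma exists_hasSum_prod_factor (j₀ : Fin p) (hj₀ : j₀.val = 0) {f : Fin p → ℕ → ℚ}
    {a : Fin p → ℕ} (hf : ∀ i, f i ∈ polar (a i)) :
    ∃ Φ ∈ Submodule.span ℚ (laGen j₀ p (∑ i, a i)), ∀ z : Fin p → ℂˣ,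
      InDomain j₀ (fun j => z j) →
      HasSum (fun k : Index p => ∏ i, factor (fun j => z j) (f i, Pi.single i 1) (k.1 i - 1))
        (Φ z) := by
  obtain ⟨p, rfl⟩ : ∃ q, p = q + 1 := ⟨p - 1, by have := j₀.2; omega⟩
  obtain rfl : j₀ = 0 := Fin.ext hj₀
  have hv : ∀ i : Fin (p + 1), (Pi.single i 1 : Fin (p + 1) → ℕ) ≠ 0 := fun i => by simp
  -- The outermost summation is treated apart to retain the lower bound on the first vector, which
  -- `nest_mem` forgets.
  have h := nest_mem_succ (v := fun i => Pi.single i 1) (hf 0) (hv 0)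
    (nest_mem _ _ _ (fun i => hf i.succ) (fun i => hv i.succ))
  have h1 : ∑ i : Fin (p + 1), (Pi.single i 1 : Fin (p + 1) → ℕ) = 1 := by
    ext j
    simp [Finset.sum_apply, Pi.single_apply]
  rw [h1] at h
  obtain ⟨Φ, hΦ, H⟩ := exists_tendsto_of_mem_nestSpan h
  refine ⟨Φ, hΦ, fun z hz => ?_⟩
  have hs : Summable fun k : Index (p + 1) =>
      ∏ i, factor (fun j => (z j : ℂ)) (f i, Pi.single i 1) (k.1 i - 1) := by
    refine summable_prod_factor hz (g := fun i => (f i, Pi.single i 1))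
      (fun i => polyBounded_of_mem_polar (hf i)) fun i hi => ?_
    obtain rfl : i = 0 := Fin.ext hi
    simp
  rw [tendsto_nhds_unique (H z hz)
    (tendsto_nest (g := fun i => factor (fun j => (z j : ℂ)) (f i, Pi.single i 1)) hs)]
  exact hs.hasSum

/-! ### Return to the original series. -/

lemma decay_single (z : Fin p → ℂ) (i : Fin p) {k : ℕ} (hk : 1 ≤ k) :
    decay z (Pi.single i 1) (k - 1) = z i ^ (-(k : ℤ)) := by
  have : ∏ j, z j ^ (Pi.single i 1 : Fin p → ℕ) j = z i := by
    rw [prod_eq_single i (fun j _ hj => by simp [hj]) (by simp)]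
    simp
  rw [decay, this, Nat.sub_add_cancel hk, zpow_neg, zpow_natCast, inv_pow]

lemma seriesTerm_eq_sum (P : MvPolynomial (Fin p) ℚ) (A n : Fin p → ℕ) (z : Fin p → ℂ)
    (k : Index p) :
    seriesTerm P A n z k = ∑ d ∈ P.support, ((P.coeff d : ℚ) : ℂ) *
      ∏ i, factor z (fun m => ((m : ℚ) + 1) ^ d i /
        ((ascPochhammer ℚ (n i + 1)).eval ((m : ℚ) + 1)) ^ A i, Pi.single i 1) (k.1 i - 1) := by
  rw [seriesTerm, MvPolynomial.aeval_def, MvPolynomial.eval₂_eq', sum_div, sum_mul]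
  refine sum_congr rfl fun d _ => ?_
  rw [mul_div_assoc, mul_assoc, ← prod_div_distrib, ← prod_mul_distrib]
  congr 1
  refine prod_congr rfl fun i _ => ?_
  rw [factor, decay_single z i (k.2.2 i)]
  congr 1
  have hk' : ((k.1 i - 1 : ℕ) : ℚ) + 1 = k.1 i := by
    exact_mod_cast congrArg (Nat.cast (R := ℚ)) (Nat.sub_add_cancel (k.2.2 i))
  simp only [hk']
  push_cast
  congr 2
  have := ascPochhammer_eval_cast ℂ (n i + 1) (k.1 i)
  have h' := ascPochhammer_eval_cast ℚ (n i + 1) (k.1 i)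
  exact this.symm.trans (by rw [← h', Rat.cast_natCast])

lemma exists_hasSum_seriesTerm (j₀ : Fin p) (hj₀ : j₀.val = 0) (P : MvPolynomial (Fin p) ℚ)
    (A n : Fin p → ℕ) :
    ∃ Φ ∈ Submodule.span ℚ (laGen j₀ p (∑ i, A i)), ∀ z : Fin p → ℂˣ,
      InDomain j₀ (fun j => z j) → HasSum (seriesTerm P A n fun j => z j) (Φ z) := by
  choose Φ hΦ H using fun d : Fin p →₀ ℕ => exists_hasSum_prod_factor j₀ hj₀
    (fun i => monomial_div_ascPochhammer_mem (d i) (n i) (A i))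
  refine ⟨∑ d ∈ P.support, P.coeff d • Φ d,
    sum_mem fun d _ => Submodule.smul_mem _ _ (hΦ d), fun z hz => ?_⟩
  rw [funext (seriesTerm_eq_sum P A n fun j => (z j : ℂ)), Finset.sum_apply]
  refine hasSum_sum fun d _ => ?_
  rw [Pi.smul_apply, Rat.smul_def]
  exact (H d z hz).mul_left _

lemma evalAt_single (z : Fin p → ℂ) (e : Fin p → ℤ) (a : ℚ) :
    Laurent.evalAt z (AddMonoidAlgebra.single e a) = a * monomialAt z e := by
  simp [Laurent.evalAt, monomialAt]

end MultiplePolylog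

theorem mainTheorem2 {p : ℕ} (hp : 0 < p) (P : MvPolynomial (Fin p) ℚ) (A n : Fin p → ℕ)
    (hA : ∀ j, 1 ≤ A j) :
    ∃ (m : ℕ) (q : Fin m → ℕ) (s : ∀ t : Fin m, Fin (q t) → ℤ)
      (S : ∀ t : Fin m, Fin (q t) → Finset (Fin p)) (c : Fin m → Laurent p),
      (∀ t, q t ≤ p ∧ weight (s t) ≤ ∑ j, (A j : ℤ) ∧ ∀ i, (S t i).Nonempty) ∧
      ∀ z : Fin p → ℂ, 1 < ‖z ⟨0, hp⟩‖ → (∀ j, j ≠ ⟨0, hp⟩ → 1 ≤ ‖z j‖) →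
        (∀ t, Summable (laTerm (s t) fun i => 1 / ∏ j ∈ S t i, z j)) ∧
        HasSum (seriesTerm P A n z)
          (∑ t, (c t).evalAt z * La (s t) fun i => 1 / ∏ j ∈ S t i, z j) := by
  obtain ⟨Φ, hΦ, H⟩ := exists_hasSum_seriesTerm ⟨0, hp⟩ rfl P A n
  obtain ⟨m, r, g, rfl⟩ := Submodule.mem_span_set'.1 hΦ
  choose e q s S hq hw hS hsum hg using fun t => (g t).2
  refine ⟨m, q, s, S, fun t => AddMonoidAlgebra.single (e t) (r t),
    fun t => ⟨hq t, by exact_mod_cast hw t, hS t⟩, fun z hz0 hz => ?_⟩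
  have hz' : InDomain ⟨0, hp⟩ z := by
    refine ⟨hz0, fun j => ?_⟩
    by_cases h : j = ⟨0, hp⟩
    · exact h ▸ hz0.le
    · exact hz j h
  refine ⟨fun t => hsum t z hz', ?_⟩
  -- All coordinates have norm at least `1`, hence are invertible.
  lift z to Fin p → ℂˣ using fun j =>
    isUnit_iff_ne_zero.2 (norm_pos_iff.1 (zero_lt_one.trans_le (hz'.2 j)))
  convert H z hz' using 1
  rw [Finset.sum_apply]
  refine Finset.sum_congr rfl fun t _ => ?_
  rw [Pi.smul_apply, Rat.smul_def, hg t, evalAt_single, mul_assoc]
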